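/- Let $d$ be the number of assets, $\mathcal X=\{1,\dots,k\}$ the set of regimes and $T>0$. Let $r(i)\ge 0$, let $\sigma(i)$ be an invertible real $d\times d$ matrix for each $i\in\mathcal X$, put $a(i)=\sigma(i)\sigma(i)^{\top}$, and let $\Lambda=(\lambda_{ij})$ be a $k\times k$ matrix with non-negative off-diagonal entries and zero row sums. For a function $\phi(t,s,i)$ put $$\mathbb L\phi(t,s,i)=r(i)\sum_{l}s_l\frac{\partial\phi}{\partial s_l}(t,s,i)+\frac12\sum_{l,l'}a_{ll'}(i)s_ls_{l'}\frac{\partial^2\phi}{\partial s_l\partial s_{l'}}(t,s,i)-r(i)\phi(t,s,i)+\sum_{j}\lambda_{ij}\phi(t,s,j).$$ Let $\mathcal K:(0,\infty)^d\to[0,\infty)$ be Lipschitz, let $0\le s_l^b<s_l^u<\infty$ for $l=1,\dots,d$, $R=\prod_{l}(s_l^b,s_l^u)$ and $\Gamma=\partial R\cap(0,\infty)^d$. For an open set $U\subseteq(0,\infty)^d$, a classical solution on $U$ is a function that is continuous on $[0,T]\times(\overline U\cap(0,\infty)^d)\times\mathcal X$, of at most linear growth in $s$ there, of class $C^{1,2}$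 in $(0,T)\times U$ for each regime, and satisfies $\partial_t\phi+\mathbb L\phi=0$ on $(0,T)\times U\times\mathcal X$ and $\phi(T,s,i)=\mathcal K(s)$ for $s\in U$, $i\in\mathcal X$. Let $v$ be a classical solution on $(0,\infty)^d$, and let $w$ be a classical solution on $R$ with the artificial boundary condition $w=h$ on $(0,T)\times\Gamma\times\mathcal X$. Assume that the artificial data are wrong on the far facets only: $h(t,s,i)=v(t,s,i)$ for all $t\in(0,T)$, $i\in\mathcal X$ and all $s\in\Gamma$ with $s_l<s_l^u$ for every $l$ (there is no such $s$ if $s^b=0$). Put $A_l=\max_i a_{ll}(i)$, $D_l=\min_i\{a_{ll}(i)-2r(i)\}$ and $D_l^+=\max\{D_l,0\}$. Then for every $(t',s',i')\in[0,T]\times R\times\mathcal X$ the error $|v-w|$ is bounded on $[t',T)\times\Gamma\times\mathcal X$, and $$|v(t',s',i')-w(t',s',i')|\le\sup_{[t',T)\times\Gamma\times\mathcal X}|v-w|\;\sum_{l=1}^d\exp\left(\frac{-\ln\frac{s_l^u}{s_l'}\left(\frac{D_l^+}{A_l}\ln\frac{s_l^u}{s_l'}+2\right)+(A_l+|D_l|)(T-t')}{2\left(D_l^+(T-t')+\frac{A_l}{A_l+D_l^+}\right)}\right),$$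 where the supremum over the empty set (the case $t'=T$) is $0$. -/

import Mathlib

open Set

noncomputable section

namespace RegimeSwitching

/-- Coefficients of the regime-switching market with `d` risky assets and `k` regimes: interest
rates `r`, invertible volatility matrices `σ`, and the rate matrix `Λ` of a Markov chain. -/
structure Model (d k : ℕ) where
  r : Fin k → ℝ
  σ : Fin k → Matrix (Fin d) (Fin d) ℝ
  Λ : Matrix (Fin k) (Fin k) ℝ
  r_nonneg : ∀ i, 0 ≤ r i
  σ_invertible : ∀ i, IsUnit (σ i)
  Λ_offDiag : ∀ i j, i ≠ j → 0 ≤ Λ i j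
  Λ_rowSum : ∀ i, ∑ j, Λ i j = 0

variable {d k : ℕ}

/-- The diffusion matrix `a(i) = σ(i) σ(i)ᵀ`. -/
def Model.a (m : Model d k) (i : Fin k) : Matrix (Fin d) (Fin d) ℝ :=
  m.σ i * (m.σ i).transpose

/-- `max_i a_ll(i)`, a maximum over the finitely many regimes. -/
def Model.amax (m : Model d k) (l : Fin d) : ℝ := ⨆ i, m.a i l l

/-- `D_l = min_i (a_ll(i) - 2 r(i))`, a minimum over the finitely many regimes. -/
def Model.D (m : Model d k) (l : Fin d) : ℝ := ⨅ i, (m.a i l l - 2 * m.r i)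

/-- The partial derivative `∂g/∂s_l` at `s`. -/
def pd (l : Fin d) (g : (Fin d → ℝ) → ℝ) (s : Fin d → ℝ) : ℝ :=
  fderiv ℝ g s (Pi.single l 1)

/-- The spatial operator `𝕃` applied to `f` (time frozen), at the point `s` and regime `i`. -/
def Model.L (m : Model d k) (f : (Fin d → ℝ) → Fin k → ℝ) (s : Fin d → ℝ) (i : Fin k) : ℝ :=
  m.r i * ∑ l, s l * pd l (fun x => f x i) s
    + (1 / 2) * ∑ l, ∑ l', m.a i l l' * s l * s l' * pd l (pd l' (fun x => f x i)) s
    - m.r i * f s i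
    + ∑ j, m.Λ i j * f s j

/-- The open positive orthant `(0,∞)^d`. -/
def orthant (d : ℕ) : Set (Fin d → ℝ) := {s | ∀ l, 0 < s l}

/-- The truncated space domain `R = ∏ (b_l, u_l)`. -/
def box (b u : Fin d → ℝ) : Set (Fin d → ℝ) := {s | ∀ l, b l < s l ∧ s l < u l}

/-- The artificial boundary `Γ = ∂R ∩ (0,∞)^d`. -/
def Gam (b u : Fin d → ℝ) : Set (Fin d → ℝ) := frontier (box b u) ∩ orthant d

/-- The class `C^{1,2}((0,T) × U)`, for an open set `U`. -/
structure IsC12On (T : ℝ) (U : Set (Fin d → ℝ)) (g : ℝ → (Fin d → ℝ) → ℝ) : Prop where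
  diff_time : ∀ t ∈ Ioo 0 T, ∀ s ∈ U, DifferentiableAt ℝ (fun τ => g τ s) t
  diff_space : ∀ t ∈ Ioo 0 T, ContDiffOn ℝ 2 (g t) U
  cont_time : ContinuousOn (fun p : ℝ × (Fin d → ℝ) => deriv (fun τ => g τ p.2) p.1)
    (Ioo 0 T ×ˢ U)
  cont_fst : ∀ l, ContinuousOn (fun p : ℝ × (Fin d → ℝ) => pd l (g p.1) p.2) (Ioo 0 T ×ˢ U)
  cont_snd : ∀ l l', ContinuousOn (fun p : ℝ × (Fin d → ℝ) => pd l (pd l' (g p.1)) p.2)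
    (Ioo 0 T ×ˢ U)

/-- `f` is a classical solution on `[0,T] × (closure U ∩ (0,∞)^d) × 𝒳`, with at most linear growth,
of the system `∂f/∂t + 𝕃 f = 0` in `(0,T) × U × 𝒳` with terminal value `K` at time `T`. Here `U` is
an open subset of the orthant. -/
structure IsClassicalSolution (m : Model d k) (T : ℝ) (U : Set (Fin d → ℝ)) (K : (Fin d → ℝ) → ℝ)
    (f : ℝ → (Fin d → ℝ) → Fin k → ℝ) : Prop where
  cont : ∀ i, ContinuousOn (fun p : ℝ × (Fin d → ℝ) => f p.1 p.2 i)
    (Icc 0 T ×ˢ (closure U ∩ orthant d))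
  smooth : ∀ i, IsC12On T U (fun t s => f t s i)
  growth : ∃ C : ℝ, ∀ t ∈ Icc 0 T, ∀ s ∈ closure U ∩ orthant d, ∀ i,
    |f t s i| ≤ C * (1 + ∑ l, |s l|)
  pde : ∀ t ∈ Ioo 0 T, ∀ s ∈ U, ∀ i, deriv (fun τ => f τ s i) t + m.L (f t) s i = 0
  terminal : ∀ s ∈ U, ∀ i, f T s i = K s

/-- `v` solves the problem on the full space domain `(0,∞)^d`. -/
def SolvesFull (m : Model d k) (T : ℝ) (K : (Fin d → ℝ) → ℝ)
    (v : ℝ → (Fin d → ℝ) → Fin k → ℝ) : Prop :=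
  IsClassicalSolution m T (orthant d) K v

/-- `w` solves the problem on the truncated space domain `box b u` with boundary data `h`. -/
def SolvesTruncated (m : Model d k) (T : ℝ) (b u : Fin d → ℝ) (K : (Fin d → ℝ) → ℝ)
    (h w : ℝ → (Fin d → ℝ) → Fin k → ℝ) : Prop :=
  IsClassicalSolution m T (box b u) K w ∧
    ∀ t ∈ Ioo 0 T, ∀ s ∈ Gam b u, ∀ i, w t s i = h t s i

/-- The values of `|v - w|` on `[t', T) × Γ × 𝒳`. -/
def boundaryErrors (T : ℝ) (b u : Fin d → ℝ) (v w : ℝ → (Fin d → ℝ) → Fin k → ℝ) (t' : ℝ) :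
    Set ℝ :=
  {e | ∃ t ∈ Ico t' T, ∃ s ∈ Gam b u, ∃ i, e = |v t s i - w t s i|}

end RegimeSwitching

end

namespace RegimeSwitching

open Filter Topology

variable {d k : ℕ}

/-! Both differences $f=\pm(v-w)$ solve the backward system on $R$ with zero terminal data. They
vanish on the near part of $\Gamma$ and are at most $M=\sup|v-w|$ on the far facets, so a comparison
principle applies.

Separable powers serve as barriers: $M(s_l/u_l)^{\theta_l}e^{\kappa_l(T-t)}$ is a supersolution in
every regime as soon as $r\theta_l+\tfrac12 a_{ll}\theta_l(\theta_l-1)-r\le\kappa_l$. With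
$\kappa_l\ge0$ it is at least $M$ on the facet $s_l=s_l^u$, so the sum over $l$ dominates $f$ on all
of $\Gamma$. Where a price tends to $0$ no boundary value is given. There an added $-\varepsilon\ln
s_l$ beats the bounded function $f$, and a further $\varepsilon$-term in time makes the
supersolution strict (`barrier_strict`). A positive maximum of $f$ minus the barrier then
contradicts the equation (`IsClassicalSolution.le_barrier`), and $\varepsilon\to0$ removes the
correction.

The exponents are free, so they may depend on $(t',s')$; `exists_exponents` chooses them to reach
the stated bound. -/

/-! ### Geometry of the truncated domain -/

theorem box_eq_pi (b u : Fin d → ℝ) : box b u = Set.pi univ fun l => Ioo (b l) (u l) := by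
  ext s; simp [box]

theorem isOpen_box (b u : Fin d → ℝ) : IsOpen (box b u) := by
  rw [box_eq_pi]; exact isOpen_set_pi finite_univ fun _ _ => isOpen_Ioo

theorem isOpen_orthant : IsOpen (orthant d) := by
  have : orthant d = Set.pi univ fun _ => Ioi 0 := by ext s; simp [orthant]
  rw [this]; exact isOpen_set_pi finite_univ fun _ _ => isOpen_Ioi

theorem closure_box {b u : Fin d → ℝ} (hbu : ∀ l, b l < u l) :
    closure (box b u) = {s | ∀ l, b l ≤ s l ∧ s l ≤ u l} := by
  rw [box_eq_pi, closure_pi_set]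
  ext s; simp [closure_Ioo (hbu _).ne, Pi.le_def, forall_and]

theorem mem_Gam {b u : Fin d → ℝ} {s : Fin d → ℝ} :
    s ∈ Gam b u ↔ s ∈ closure (box b u) ∧ s ∉ box b u ∧ s ∈ orthant d := by
  rw [Gam, (isOpen_box b u).frontier_eq]; simp [and_assoc]

theorem box_subset_orthant {b u : Fin d → ℝ} (hb : ∀ l, 0 ≤ b l) : box b u ⊆ orthant d :=
  fun _ hs l => (hb l).trans_lt (hs l).1

/-! ### First and second partial derivatives -/

theorem pd_sub {l : Fin d} {f g : (Fin d → ℝ) → ℝ} {s : Fin d → ℝ}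
    (hf : DifferentiableAt ℝ f s) (hg : DifferentiableAt ℝ g s) :
    pd l (fun x => f x - g x) s = pd l f s - pd l g s := by
  simp [pd, fderiv_fun_sub hf hg]

theorem eventually_differentiableAt {f : (Fin d → ℝ) → ℝ} {s : Fin d → ℝ}
    (hf : ContDiffAt ℝ 2 f s) : ∀ᶠ x in 𝓝 s, DifferentiableAt ℝ f x :=
  (hf.eventually (by simp)).mono fun _ hx => hx.differentiableAt (by simp)

theorem differentiableAt_fderiv {f : (Fin d → ℝ) → ℝ} {s : Fin d → ℝ}
    (hf : ContDiffAt ℝ 2 f s) : DifferentiableAt ℝ (fderiv ℝ f) s :=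
  (hf.fderiv_right (m := 1) (by norm_num)).differentiableAt (by simp)

theorem differentiableAt_pd {l : Fin d} {f : (Fin d → ℝ) → ℝ} {s : Fin d → ℝ}
    (hf : ContDiffAt ℝ 2 f s) : DifferentiableAt ℝ (pd l f) s :=
  (differentiableAt_fderiv hf).clm_apply (differentiableAt_const _)

theorem pd_congr {l : Fin d} {f g : (Fin d → ℝ) → ℝ} {s : Fin d → ℝ} (h : f =ᶠ[𝓝 s] g) :
    pd l f s = pd l g s := by
  simp [pd, h.fderiv_eq]

theorem pd_pd_sub {l l' : Fin d} {f g : (Fin d → ℝ) → ℝ} {s : Fin d → ℝ}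
    (hf : ContDiffAt ℝ 2 f s) (hg : ContDiffAt ℝ 2 g s) :
    pd l (pd l' fun x => f x - g x) s = pd l (pd l' f) s - pd l (pd l' g) s := by
  rw [← pd_sub (differentiableAt_pd hf) (differentiableAt_pd hg)]
  apply pd_congr
  filter_upwards [eventually_differentiableAt hf, eventually_differentiableAt hg] with x h1 h2
  exact pd_sub h1 h2

theorem Model.L_sub (m : Model d k) {f g : (Fin d → ℝ) → Fin k → ℝ} {s : Fin d → ℝ} {i : Fin k}
    (hf : ContDiffAt ℝ 2 (fun x => f x i) s) (hg : ContDiffAt ℝ 2 (fun x => g x i) s) :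
    m.L (fun x j => f x j - g x j) s i = m.L f s i - m.L g s i := by
  have h1 (l) := pd_sub (l := l) (hf.differentiableAt (by simp)) (hg.differentiableAt (by simp))
  have h2 (l l') := pd_pd_sub (l := l) (l' := l') hf hg
  simp only [Model.L, h1, h2, mul_sub, Finset.sum_sub_distrib]
  ring

theorem pd_pd_eq {l l' : Fin d} {f : (Fin d → ℝ) → ℝ} {s : Fin d → ℝ} (hf : ContDiffAt ℝ 2 f s) :
    pd l (pd l' f) s = fderiv ℝ (fderiv ℝ f) s (Pi.single l 1) (Pi.single l' 1) := by
  have := (differentiableAt_fderiv hf).hasFDerivAt.clm_apply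
    (hasFDerivAt_const (Pi.single l' (1 : ℝ)) s)
  unfold pd
  erw [this.fderiv]
  simp

theorem sum_smul_single (w : Fin d → ℝ) : ∑ l, w l • Pi.single l (1 : ℝ) = w := by
  ext j
  simp [Finset.sum_apply, Pi.single_apply]

/-- At a local maximum, the second derivative is negative semidefinite. -/
theorem fderiv_fderiv_nonpos {f : (Fin d → ℝ) → ℝ} {s : Fin d → ℝ} (hf : ContDiffAt ℝ 2 f s)
    (hmax : IsLocalMax f s) (w : Fin d → ℝ) : fderiv ℝ (fderiv ℝ f) s w w ≤ 0 := by
  have hline (x : ℝ) : HasDerivAt (fun x : ℝ => s + x • w) w x := by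
    simpa using ((hasDerivAt_id x).smul_const w).const_add s
  have hct : Tendsto (fun x : ℝ => s + x • w) (𝓝 0) (𝓝 s) := by
    simpa using (hline 0).continuousAt.tendsto
  have h1 : deriv (fun x : ℝ => f (s + x • w)) =ᶠ[𝓝 0] fun x => fderiv ℝ f (s + x • w) w := by
    filter_upwards [hct.eventually (eventually_differentiableAt hf)] with x hx
    exact (hx.hasFDerivAt.comp_hasDerivAt x (hline x)).deriv
  have h2 : HasDerivAt (fun x : ℝ => fderiv ℝ f (s + x • w) w)
      (fderiv ℝ (fderiv ℝ f) s w w) 0 := by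
    have h3 : HasFDerivAt (fderiv ℝ f) (fderiv ℝ (fderiv ℝ f) s) (s + (0 : ℝ) • w) := by
      simpa using (differentiableAt_fderiv hf).hasFDerivAt
    exact ((ContinuousLinearMap.apply ℝ ℝ w).hasFDerivAt.comp _ h3).comp_hasDerivAt (0 : ℝ) (hline 0)
  have h4 : deriv (deriv fun x : ℝ => f (s + x • w)) 0 = fderiv ℝ (fderiv ℝ f) s w w := by
    rw [h1.deriv_eq, h2.deriv]
  have hmax' : IsLocalMax (fun x : ℝ => f (s + x • w)) 0 := by
    filter_upwards [hct.eventually hmax] with x hx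
    simpa using hx
  -- A positive second derivative would make the critical point a local minimum as well, hence the
  -- line restriction locally constant, with second derivative zero.
  by_contra! hpos
  have hmin := isLocalMin_of_deriv_deriv_pos (h4 ▸ hpos) hmax'.deriv_eq_zero
    (by
      have h5 : ContinuousAt f (s + (0 : ℝ) • w) := by simpa using hf.continuousAt
      exact ContinuousAt.comp (f := fun x : ℝ => s + x • w) h5 (hline 0).continuousAt)
  have hconst : (fun x : ℝ => f (s + x • w)) =ᶠ[𝓝 0] fun _ => f (s + (0 : ℝ) • w) := by
    filter_upwards [hmin, hmax'] with x hx hx' using le_antisymm hx' hx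
  have h6 : deriv (deriv fun x : ℝ => f (s + x • w)) 0 = 0 := by
    rw [hconst.deriv.deriv_eq]; simp
  linarith

theorem Model.sum_a_pd_pd_nonpos (m : Model d k) (i : Fin k) {f : (Fin d → ℝ) → ℝ} {s : Fin d → ℝ}
    (hf : ContDiffAt ℝ 2 f s) (hmax : IsLocalMax f s) :
    ∑ l, ∑ l', m.a i l l' * s l * s l' * pd l (pd l' f) s ≤ 0 := by
  -- Since $a=\sigma\sigma^\top$, the diffusion term is a sum over the columns $n$ of $\sigma$ of
  -- the Hessian form in the direction $(s_l\sigma_{ln})_l$.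
  have key (n : Fin d) : ∑ l, ∑ l', m.σ i l n * m.σ i l' n * s l * s l' * pd l (pd l' f) s ≤ 0 := by
    convert fderiv_fderiv_nonpos hf hmax (fun l => s l * m.σ i l n) using 1
    conv_rhs => rw [← sum_smul_single (fun l => s l * m.σ i l n)]
    simp only [pd_pd_eq hf, map_sum, map_smul, _root_.sum_apply,
      _root_.smul_apply, smul_eq_mul, Finset.mul_sum]
    rw [Finset.sum_comm]
    refine Finset.sum_congr rfl fun l _ => Finset.sum_congr rfl fun l' _ => ?_
    ring
  calc ∑ l, ∑ l', m.a i l l' * s l * s l' * pd l (pd l' f) s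
      = ∑ n, ∑ l, ∑ l', m.σ i l n * m.σ i l' n * s l * s l' * pd l (pd l' f) s := by
        rw [Finset.sum_comm]
        refine Eq.trans ?_ (Finset.sum_congr rfl fun n _ => Finset.sum_comm)
        rw [Finset.sum_comm (s := Finset.univ (α := Fin d))]
        conv_rhs => rw [Finset.sum_comm]
        rw [Finset.sum_comm]
        refine Finset.sum_congr rfl fun l _ => ?_
        conv_rhs => rw [Finset.sum_comm]
        refine Finset.sum_congr rfl fun l' _ => ?_
        simp only [Model.a, Matrix.mul_apply, Matrix.transpose_apply, Finset.sum_mul]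
    _ ≤ 0 := Finset.sum_nonpos fun n _ => key n

/-- Elliptic maximum principle for the coupled system. The maximum must also be over regimes: the
off-diagonal rates are nonnegative and rows sum to zero, so the coupling term is then nonpositive.
-/
theorem Model.L_nonpos_of_isLocalMax (m : Model d k) {f : (Fin d → ℝ) → Fin k → ℝ}
    {s : Fin d → ℝ} {i : Fin k} (hf : ContDiffAt ℝ 2 (fun x => f x i) s)
    (hmax : IsLocalMax (fun x => f x i) s) (hi : ∀ j, f s j ≤ f s i) (h0 : 0 ≤ f s i) :
    m.L f s i ≤ 0 := by
  have h1 (l) : pd l (fun x => f x i) s = 0 := by simp [pd, hmax.fderiv_eq_zero]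
  have h2 := m.sum_a_pd_pd_nonpos i hf hmax
  have h3 : ∑ j, m.Λ i j * f s j ≤ 0 := by
    calc ∑ j, m.Λ i j * f s j ≤ ∑ j, m.Λ i j * f s i := by
          refine Finset.sum_le_sum fun j _ => ?_
          rcases eq_or_ne i j with rfl | hij
          · rfl
          · exact mul_le_mul_of_nonneg_left (hi j) (m.Λ_offDiag i j hij)
      _ = 0 := by rw [← Finset.sum_mul, m.Λ_rowSum, zero_mul]
  have h4 := mul_nonneg (m.r_nonneg i) h0
  simp only [Model.L, h1, mul_zero, Finset.sum_const_zero]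
  linarith

/-- One-sided, because the maximum over the cylinder may sit at its initial time. -/
theorem deriv_nonpos_of_le_right {g : ℝ → ℝ} {g' t t₁ : ℝ} (hg : HasDerivAt g g' t) (ht : t < t₁)
    (h : ∀ τ ∈ Ioo t t₁, g τ ≤ g t) : g' ≤ 0 := by
  have h1 := (hasDerivWithinAt_iff_tendsto_slope' (self_notMem_Ioi (a := t))).1
    (hg.hasDerivWithinAt (s := Ioi t))
  refine le_of_tendsto h1 ?_
  filter_upwards [Ioo_mem_nhdsGT ht] with τ hτ
  rw [slope_def_field]
  exact div_nonpos_of_nonpos_of_nonneg (by linarith [h τ hτ]) (by linarith [hτ.1])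

/-! ### Sums of functions of one price each -/

theorem hasFDerivAt_sum_comp {g g' : Fin d → ℝ → ℝ} {s : Fin d → ℝ} (c : ℝ)
    (hg : ∀ l, HasDerivAt (g l) (g' l (s l)) (s l)) :
    HasFDerivAt (fun x : Fin d → ℝ => c + ∑ l, g l (x l))
      (∑ l, g' l (s l) • ContinuousLinearMap.proj (R := ℝ) (φ := fun _ : Fin d => ℝ) l) s :=
  (HasFDerivAt.fun_sum fun l _ => (hg l).comp_hasFDerivAt s
    (ContinuousLinearMap.proj (R := ℝ) (φ := fun _ : Fin d => ℝ) l).hasFDerivAt).const_add c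

/-- A separable function has a diagonal Hessian, so only the $a_{ll}$ survive; the zero row sums of
$\Lambda$ annihilate anything independent of the regime. -/
theorem Model.L_sum_comp (m : Model d k) {g g' g'' : Fin d → ℝ → ℝ} (c : ℝ)
    (hg : ∀ l, ∀ x, 0 < x → HasDerivAt (g l) (g' l x) x)
    (hg' : ∀ l, ∀ x, 0 < x → HasDerivAt (g' l) (g'' l x) x) {s : Fin d → ℝ} (hs : s ∈ orthant d)
    (i : Fin k) :
    m.L (fun x _ => c + ∑ l, g l (x l)) s i =
      -m.r i * c + ∑ l, (m.r i * (s l * g' l (s l)) + m.a i l l / 2 * (s l ^ 2 * g'' l (s l))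
        - m.r i * g l (s l)) := by
  have h1 (l) (x : Fin d → ℝ) (hx : x ∈ orthant d) :
      pd l (fun x : Fin d → ℝ => c + ∑ l, g l (x l)) x = g' l (x l) := by
    rw [pd, (hasFDerivAt_sum_comp c fun l => hg l _ (hx l)).fderiv]
    simp [Pi.single_apply]
  have h2 (l l') : pd l (pd l' fun x : Fin d → ℝ => c + ∑ l, g l (x l)) s =
      if l = l' then g'' l (s l) else 0 := by
    rw [pd_congr (g := fun x => g' l' (x l'))
      (by filter_upwards [isOpen_orthant.mem_nhds hs] with x hx using h1 l' x hx), pd]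
    have h3 : HasFDerivAt (fun x : Fin d → ℝ => g' l' (x l')) _ s :=
      (hg' l' _ (hs l')).comp_hasFDerivAt s
        (ContinuousLinearMap.proj (R := ℝ) (φ := fun _ : Fin d => ℝ) l').hasFDerivAt
    rw [h3.fderiv]
    by_cases h : l = l'
    · subst h; simp
    · simp [h, Ne.symm h]
  have h3 (l) : ∑ l', m.a i l l' * s l * s l' * (if l = l' then g'' l (s l) else 0) =
      m.a i l l * s l * s l * g'' l (s l) := by simp
  simp only [Model.L, h1 _ s hs, h2, h3, ← Finset.sum_mul, m.Λ_rowSum, zero_mul, add_zero]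
  simp only [Finset.sum_sub_distrib, Finset.sum_add_distrib, mul_add, Finset.mul_sum]
  have h4 : ∑ l, 1 / 2 * (m.a i l l * s l * s l * g'' l (s l)) =
      ∑ l, m.a i l l / 2 * (s l ^ 2 * g'' l (s l)) :=
    Finset.sum_congr rfl fun l _ => by ring
  rw [h4]; ring

/-! ### Restrictions and differences of classical solutions -/

theorem IsC12On.mono {T : ℝ} {U V : Set (Fin d → ℝ)} {g : ℝ → (Fin d → ℝ) → ℝ}
    (hg : IsC12On T V g) (h : U ⊆ V) : IsC12On T U g where
  diff_time t ht s hs := hg.diff_time t ht s (h hs)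
  diff_space t ht := (hg.diff_space t ht).mono h
  cont_time := hg.cont_time.mono (prod_mono_right h)
  cont_fst l := (hg.cont_fst l).mono (prod_mono_right h)
  cont_snd l l' := (hg.cont_snd l l').mono (prod_mono_right h)

theorem IsC12On.contDiffAt {T : ℝ} {U : Set (Fin d → ℝ)} {g : ℝ → (Fin d → ℝ) → ℝ}
    (hg : IsC12On T U g) (hU : IsOpen U) {t : ℝ} (ht : t ∈ Ioo 0 T) {s : Fin d → ℝ} (hs : s ∈ U) :
    ContDiffAt ℝ 2 (g t) s :=
  (hg.diff_space t ht).contDiffAt (hU.mem_nhds hs)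

theorem IsC12On.sub {T : ℝ} {U : Set (Fin d → ℝ)} {f g : ℝ → (Fin d → ℝ) → ℝ}
    (hU : IsOpen U) (hf : IsC12On T U f) (hg : IsC12On T U g) :
    IsC12On T U fun t s => f t s - g t s where
  diff_time t ht s hs := (hf.diff_time t ht s hs).sub (hg.diff_time t ht s hs)
  diff_space t ht := (hf.diff_space t ht).sub (hg.diff_space t ht)
  cont_time := (hf.cont_time.sub hg.cont_time).congr fun p hp =>
    deriv_fun_sub (hf.diff_time _ hp.1 _ hp.2) (hg.diff_time _ hp.1 _ hp.2)
  cont_fst l := ((hf.cont_fst l).sub (hg.cont_fst l)).congr fun p hp =>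
    pd_sub ((hf.contDiffAt hU hp.1 hp.2).differentiableAt (by simp))
      ((hg.contDiffAt hU hp.1 hp.2).differentiableAt (by simp))
  cont_snd l l' := ((hf.cont_snd l l').sub (hg.cont_snd l l')).congr fun p hp =>
    pd_pd_sub (hf.contDiffAt hU hp.1 hp.2) (hg.contDiffAt hU hp.1 hp.2)

theorem IsClassicalSolution.mono {m : Model d k} {T : ℝ} {U V : Set (Fin d → ℝ)}
    {K : (Fin d → ℝ) → ℝ} {f : ℝ → (Fin d → ℝ) → Fin k → ℝ} (hf : IsClassicalSolution m T V K f)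
    (h : U ⊆ V) : IsClassicalSolution m T U K f where
  cont i := (hf.cont i).mono (prod_mono_right (inter_subset_inter_left _ (closure_mono h)))
  smooth i := (hf.smooth i).mono h
  growth := by
    obtain ⟨C, hC⟩ := hf.growth
    exact ⟨C, fun t ht s hs => hC t ht s ⟨closure_mono h hs.1, hs.2⟩⟩
  pde t ht s hs := hf.pde t ht s (h hs)
  terminal s hs := hf.terminal s (h hs)

theorem IsClassicalSolution.sub {m : Model d k} {T : ℝ} {U : Set (Fin d → ℝ)} (hU : IsOpen U)
    {K₁ K₂ : (Fin d → ℝ) → ℝ} {f g : ℝ → (Fin d → ℝ) → Fin k → ℝ}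
    (hf : IsClassicalSolution m T U K₁ f) (hg : IsClassicalSolution m T U K₂ g) :
    IsClassicalSolution m T U (fun s => K₁ s - K₂ s) fun t s i => f t s i - g t s i where
  cont i := (hf.cont i).sub (hg.cont i)
  smooth i := (hf.smooth i).sub hU (hg.smooth i)
  growth := by
    obtain ⟨C₁, h₁⟩ := hf.growth
    obtain ⟨C₂, h₂⟩ := hg.growth
    refine ⟨C₁ + C₂, fun t ht s hs i => (abs_sub _ _).trans ?_⟩
    rw [add_mul]
    exact add_le_add (h₁ t ht s hs i) (h₂ t ht s hs i)
  pde t ht s hs i := by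
    rw [m.L_sub ((hf.smooth i).contDiffAt hU ht hs) ((hg.smooth i).contDiffAt hU ht hs),
      deriv_fun_sub ((hf.smooth i).diff_time _ ht _ hs) ((hg.smooth i).diff_time _ ht _ hs)]
    linarith [hf.pde t ht s hs i, hg.pde t ht s hs i]
  terminal s hs i := by rw [hf.terminal s hs i, hg.terminal s hs i]

/-- Linear growth is boundedness here, as $R$ is bounded. This makes the boundary supremum finite
and lets an arbitrarily small logarithm dominate near zero prices. -/
theorem IsClassicalSolution.exists_bound {m : Model d k} {T : ℝ} {b u : Fin d → ℝ}
    (hbu : ∀ l, b l < u l) {K : (Fin d → ℝ) → ℝ} {f : ℝ → (Fin d → ℝ) → Fin k → ℝ}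
    (hf : IsClassicalSolution m T (box b u) K f) :
    ∃ B, ∀ t ∈ Icc 0 T, ∀ s ∈ closure (box b u) ∩ orthant d, ∀ i, |f t s i| ≤ B := by
  obtain ⟨C, hC⟩ := hf.growth
  refine ⟨|C| * (1 + ∑ l, |u l|), fun t ht s hs i => (hC t ht s hs i).trans ?_⟩
  have h1 : ∑ l, |s l| ≤ ∑ l, |u l| := Finset.sum_le_sum fun l _ => by
    rw [abs_of_pos (hs.2 l)]
    exact (((closure_box hbu).subset hs.1) l).2.trans (le_abs_self _)
  have h2 : 0 ≤ ∑ l, |s l| := Finset.sum_nonneg fun l _ => abs_nonneg _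
  exact mul_le_mul (le_abs_self C) (by linarith) (by linarith) (abs_nonneg C)

/-- Terminal data are prescribed on $U$ only; continuity carries them to the boundary points the
maximum might reach. -/
theorem IsClassicalSolution.terminal_closure {m : Model d k} {T : ℝ} (hT : 0 < T)
    {U : Set (Fin d → ℝ)} (hU : U ⊆ orthant d)
    {f : ℝ → (Fin d → ℝ) → Fin k → ℝ}
    (hf : IsClassicalSolution m T U (fun _ => 0) f) {s : Fin d → ℝ}
    (hs : s ∈ closure U ∩ orthant d) (i : Fin k) : f T s i = 0 := by
  have h1 : ContinuousOn (fun s => f T s i) (closure U ∩ orthant d) :=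
    (hf.cont i).comp (f := fun s => (T, s)) (by fun_prop) fun x hx => ⟨right_mem_Icc.2 hT.le, hx⟩
  have h2 : Tendsto (fun s => f T s i) (𝓝[U] s) (𝓝 (f T s i)) :=
    (h1 s hs).mono_left (nhdsWithin_mono _ fun x hx => ⟨subset_closure hx, hU hx⟩)
  have := mem_closure_iff_nhdsWithin_neBot.1 hs.1
  refine tendsto_nhds_unique h2 (tendsto_const_nhds.congr' ?_)
  filter_upwards [self_mem_nhdsWithin] with x hx using (hf.terminal x hx i).symm

/-! ### The barrier function -/

/-- A strict supersolution: `M` times a sum of powers of the single prices, plus a small term which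
is infinite where a price vanishes. -/
noncomputable def barrier (T M ε C : ℝ) (u θ κ : Fin d → ℝ) (t : ℝ) (s : Fin d → ℝ) : ℝ :=
  ε * (C * (T - t) + 1) + ∑ l, (M * Real.exp (θ l * (Real.log (s l) - Real.log (u l)) +
    κ l * (T - t)) + ε * (Real.log (u l) - Real.log (s l)))

section barrier

variable {T M ε C : ℝ} {u θ κ : Fin d → ℝ}

theorem continuousOn_barrier (I : Set ℝ) :
    ContinuousOn (fun p : ℝ × (Fin d → ℝ) => barrier T M ε C u θ κ p.1 p.2) (I ×ˢ orthant d) := by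
  have h (l) : ContinuousOn (fun p : ℝ × (Fin d → ℝ) => Real.log (p.2 l)) (I ×ˢ orthant d) :=
    ContinuousOn.log (by fun_prop) fun p hp => (hp.2 l).ne'
  unfold barrier
  fun_prop

theorem contDiffAt_barrier (t : ℝ) {s : Fin d → ℝ} (hs : s ∈ orthant d) :
    ContDiffAt ℝ 2 (barrier T M ε C u θ κ t) s := by
  have h (l) : ContDiffAt ℝ 2 (fun x : Fin d → ℝ => Real.log (x l)) s :=
    ContDiffAt.log (by fun_prop) (hs l).ne'
  unfold barrier
  fun_prop

theorem hasDerivAt_barrier (t : ℝ) (s : Fin d → ℝ) :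
    HasDerivAt (fun τ => barrier T M ε C u θ κ τ s) (-(ε * C) - ∑ l, κ l * (M *
      Real.exp (θ l * (Real.log (s l) - Real.log (u l)) + κ l * (T - t)))) t := by
  have h0 : HasDerivAt (fun τ : ℝ => T - τ) (-1) t := by
    simpa using (hasDerivAt_id t).const_sub T
  have h1 := ((h0.const_mul C).add_const 1).const_mul ε
  have h2 (l) := ((((h0.const_mul (κ l)).const_add
    (θ l * (Real.log (s l) - Real.log (u l)))).exp).const_mul M).add_const
      (ε * (Real.log (u l) - Real.log (s l)))
  refine (h1.add (HasDerivAt.fun_sum fun l (_ : l ∈ Finset.univ) => h2 l)).congr_deriv ?_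
  rw [sub_eq_add_neg (-(ε * C)), ← Finset.sum_neg_distrib]
  congr 1
  · ring
  · exact Finset.sum_congr rfl fun l _ => by ring

theorem L_barrier (m : Model d k) (t : ℝ) {s : Fin d → ℝ} (hs : s ∈ orthant d) (i : Fin k) :
    m.L (fun x _ => barrier T M ε C u θ κ t x) s i =
      -m.r i * (ε * (C * (T - t) + 1)) + ∑ l,
        ((m.r i * θ l + m.a i l l * θ l * (θ l - 1) / 2 - m.r i) * (M *
          Real.exp (θ l * (Real.log (s l) - Real.log (u l)) + κ l * (T - t))) +
        ε * (m.a i l l / 2 - m.r i - m.r i * (Real.log (u l) - Real.log (s l)))) := by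
  set E : Fin d → ℝ → ℝ := fun l x =>
    Real.exp (θ l * (Real.log x - Real.log (u l)) + κ l * (T - t))
  have hE (l) (x : ℝ) (hx : 0 < x) : HasDerivAt (E l) (E l x * (θ l * x⁻¹)) x :=
    ((((Real.hasDerivAt_log hx.ne').sub_const _).const_mul _).add_const _).exp
  have hinv (x : ℝ) (hx : 0 < x) : HasDerivAt (fun y : ℝ => y⁻¹) (-(x ^ 2)⁻¹) x :=
    hasDerivAt_inv hx.ne'
  have h := m.L_sum_comp (ε * (C * (T - t) + 1))
    (g := fun l x => M * E l x + ε * (Real.log (u l) - Real.log x))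
    (g' := fun l x => M * (E l x * (θ l * x⁻¹)) + ε * (-x⁻¹))
    (g'' := fun l x => M * (E l x * (θ l * x⁻¹) * (θ l * x⁻¹) + E l x * (θ l * (-(x ^ 2)⁻¹))) +
      ε * (-(-(x ^ 2)⁻¹)))
    (fun l x hx => ((hE l x hx).const_mul M).add
      (((Real.hasDerivAt_log hx.ne').const_sub _).const_mul ε))
    (fun l x hx => (((hE l x hx).mul ((hinv x hx).const_mul _)).const_mul M).add
      ((hinv x hx).neg.const_mul ε)) hs i
  refine h.trans ?_
  congr 1
  refine Finset.sum_congr rfl fun l _ => ?_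
  have hl := (hs l).ne'
  change _ = _ * (M * E l (s l)) + _
  field_simp
  ring

/-- The powers contribute at most zero by the condition on $\kappa$. The logarithms contribute at
most $\varepsilon\sum_l a_{ll}/2$, which the time derivative $-\varepsilon C$ strictly outweighs. -/
theorem barrier_strict (m : Model d k) (hM : 0 ≤ M) (hε : 0 < ε) {i : Fin k}
    (hC : ∑ l, m.a i l l / 2 < C)
    (hκ : ∀ l, m.r i * θ l + m.a i l l * θ l * (θ l - 1) / 2 - m.r i ≤ κ l)
    {t : ℝ} (ht : t ≤ T) (hC0 : 0 ≤ C) {s : Fin d → ℝ} (hs : s ∈ orthant d)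
    (hsu : ∀ l, s l ≤ u l) :
    deriv (fun τ => barrier T M ε C u θ κ τ s) t +
      m.L (fun x _ => barrier T M ε C u θ κ t x) s i < 0 := by
  rw [(hasDerivAt_barrier t s).deriv, L_barrier m t hs i]
  have hr := m.r_nonneg i
  have h1 : 0 ≤ m.r i * (ε * (C * (T - t) + 1)) := by
    have : 0 ≤ T - t := by linarith
    positivity
  have h2 : ∑ l, ((m.r i * θ l + m.a i l l * θ l * (θ l - 1) / 2 - m.r i) * (M *
          Real.exp (θ l * (Real.log (s l) - Real.log (u l)) + κ l * (T - t))) +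
        ε * (m.a i l l / 2 - m.r i - m.r i * (Real.log (u l) - Real.log (s l)))) ≤
      ∑ l, κ l * (M * Real.exp (θ l * (Real.log (s l) - Real.log (u l)) + κ l * (T - t))) +
      ε * ∑ l, m.a i l l / 2 := by
    rw [Finset.mul_sum, ← Finset.sum_add_distrib]
    refine Finset.sum_le_sum fun l _ => add_le_add ?_ ?_
    · exact mul_le_mul_of_nonneg_right (hκ l) (by positivity)
    · refine mul_le_mul_of_nonneg_left ?_ hε.le
      have := mul_nonneg hr (sub_nonneg.2 (Real.log_le_log (hs l) (hsu l)))
      linarith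
  have h3 := mul_lt_mul_of_pos_left hC hε
  linarith

theorem le_barrier (hM : 0 ≤ M) (hε : 0 ≤ ε) (hC0 : 0 ≤ C) {t : ℝ} (ht : t ≤ T)
    {s : Fin d → ℝ} (hs : s ∈ orthant d) (hsu : ∀ l, s l ≤ u l) (l : Fin d) :
    ε + (M * Real.exp (θ l * (Real.log (s l) - Real.log (u l)) + κ l * (T - t)) +
      ε * (Real.log (u l) - Real.log (s l))) ≤ barrier T M ε C u θ κ t s := by
  have h (l) : 0 ≤ M * Real.exp (θ l * (Real.log (s l) - Real.log (u l)) + κ l * (T - t)) +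
      ε * (Real.log (u l) - Real.log (s l)) :=
    add_nonneg (by positivity)
      (mul_nonneg hε (sub_nonneg.2 (Real.log_le_log (hs l) (hsu l))))
  refine add_le_add ?_ (Finset.single_le_sum (fun l _ => h l) (Finset.mem_univ l))
  have := mul_nonneg hε (mul_nonneg hC0 (sub_nonneg.2 ht))
  linarith

theorem barrier_pos (hM : 0 ≤ M) (hε : 0 < ε) (hC0 : 0 ≤ C) {t : ℝ} (ht : t ≤ T)
    {s : Fin d → ℝ} (hs : s ∈ orthant d) (hsu : ∀ l, s l ≤ u l) :
    0 < barrier T M ε C u θ κ t s := by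
  refine add_pos_of_pos_of_nonneg ?_ (Finset.sum_nonneg fun l _ => add_nonneg (by positivity)
      (mul_nonneg hε.le (sub_nonneg.2 (Real.log_le_log (hs l) (hsu l)))))
  have := mul_nonneg hC0 (sub_nonneg.2 ht)
  positivity

end barrier

/-! ### The comparison principle on the truncated domain -/

theorem IsClassicalSolution.le_barrier {m : Model d k} {T : ℝ} (hT : 0 < T) {b u : Fin d → ℝ}
    (hb : ∀ l, 0 ≤ b l) (hbu : ∀ l, b l < u l) {f : ℝ → (Fin d → ℝ) → Fin k → ℝ}
    (hf : IsClassicalSolution m T (box b u) (fun _ => 0) f) {t₀ M ε C : ℝ} (ht₀ : t₀ ∈ Ioo 0 T)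
    (hM : 0 ≤ M) (hε : 0 < ε) (hC0 : 0 ≤ C) (hC : ∀ i, ∑ l, m.a i l l / 2 < C) {θ κ : Fin d → ℝ}
    (hκ0 : ∀ l, 0 ≤ κ l)
    (hκ : ∀ l i, m.r i * θ l + m.a i l l * θ l * (θ l - 1) / 2 - m.r i ≤ κ l)
    (hfar : ∀ t ∈ Ico t₀ T, ∀ s ∈ Gam b u, ∀ i, f t s i ≤ M)
    (hnear : ∀ t ∈ Ico t₀ T, ∀ s ∈ Gam b u, (∀ l, s l < u l) → ∀ i, f t s i ≤ 0)
    {s₀ : Fin d → ℝ} (hs₀ : s₀ ∈ box b u) (i₀ : Fin k) :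
    f t₀ s₀ i₀ ≤ barrier T M ε C u θ κ t₀ s₀ := by
  by_contra! hcon
  obtain ⟨B, hB⟩ := hf.exists_bound hbu
  have hs₀' := box_subset_orthant hb hs₀
  -- the cut-off below which the barrier dominates
  obtain ⟨δ, hδ0, hδs, hδB⟩ : ∃ δ > 0, (∀ l, δ ≤ s₀ l) ∧
      ∀ l, ∀ x, 0 < x → x ≤ δ → B ≤ ε * (Real.log (u l) - Real.log x) := by
    have h1 (l) : ∀ᶠ x in 𝓝[>] (0 : ℝ), x ≤ s₀ l ∧ B ≤ ε * (Real.log (u l) - Real.log x) := by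
      have h2 : Tendsto (fun x => ε * (Real.log (u l) - Real.log x)) (𝓝[>] 0) atTop :=
        (tendsto_atTop_add_const_left _ _
          (tendsto_neg_atBot_atTop.comp Real.tendsto_log_nhdsGT_zero)).const_mul_atTop hε
      filter_upwards [h2.eventually_ge_atTop B, Ioo_mem_nhdsGT (hs₀' l)] with x hx hx'
      exact ⟨hx'.2.le, hx⟩
    obtain ⟨δ, hδ, hδ0⟩ := ((eventually_all.2 h1).and self_mem_nhdsWithin).exists
    refine ⟨δ, hδ0, fun l => (hδ l).1, fun l x hx hxδ => (hδ l).2.trans ?_⟩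
    exact mul_le_mul_of_nonneg_left (by linarith [Real.log_le_log hx hxδ]) hε.le
  set Q : Set (ℝ × (Fin d → ℝ)) :=
    Icc t₀ T ×ˢ Set.pi univ fun l => Icc (max (b l) δ) (u l)
  have hQc : IsCompact Q := isCompact_Icc.prod (isCompact_univ_pi fun l => isCompact_Icc)
  have hQmem : Q ⊆ Icc 0 T ×ˢ (closure (box b u) ∩ orthant d) := by
    rintro ⟨t, s⟩ ⟨ht, hs⟩
    simp only [Set.mem_pi, mem_univ, true_implies, mem_Icc, sup_le_iff] at hs
    refine ⟨⟨ht₀.1.le.trans ht.1, ht.2⟩, ?_, fun l => hδ0.trans_le (hs l).1.2⟩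
    rw [closure_box hbu]
    exact fun l => ⟨(hs l).1.1, (hs l).2⟩
  have h0Q : (t₀, s₀) ∈ Q := by
    refine ⟨⟨le_rfl, ht₀.2.le⟩, fun l _ => ⟨max_le (hs₀ l).1.le (hδs l), (hs₀ l).2.le⟩⟩
  set F : ℝ → (Fin d → ℝ) → Fin k → ℝ :=
    fun t s i => f t s i - barrier T M ε C u θ κ t s
  have hcont (i) : ContinuousOn (fun p : ℝ × (Fin d → ℝ) => F p.1 p.2 i) Q :=
    ((hf.cont i).mono hQmem).sub
      ((continuousOn_barrier (Icc 0 T)).mono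
        (hQmem.trans (prod_mono_right inter_subset_right)))
  -- Maximise over the compact cylinder in each regime, then over the finitely many regimes.
  choose p hpQ hpmax using fun i => hQc.exists_isMaxOn ⟨_, h0Q⟩ (hcont i)
  have : Nonempty (Fin k) := ⟨i₀⟩
  obtain ⟨i, hi⟩ := Finite.exists_max fun i => F (p i).1 (p i).2 i
  obtain ⟨t, s, hp⟩ : ∃ t s, p i = (t, s) := ⟨_, _, rfl⟩
  have hmax : ∀ q ∈ Q, ∀ j, F q.1 q.2 j ≤ F t s i := fun q hq j => by
    have h1 := hi j
    rw [hp] at h1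
    exact (hpmax j hq).trans h1
  have htsQ : (t, s) ∈ Q := hp ▸ hpQ i
  have hpos : 0 < F t s i := (sub_pos.2 hcon).trans_le (hmax _ h0Q i₀)
  have hpos' : barrier T M ε C u θ κ t s < f t s i := sub_pos.1 hpos
  obtain ⟨ht, hs, hso⟩ : t ∈ Icc 0 T ∧ s ∈ closure (box b u) ∧ s ∈ orthant d := hQmem htsQ
  have hsc := (closure_box hbu).subset hs
  have hbar := barrier_pos (θ := θ) (κ := κ) hM hε hC0 ht.2 hso fun l => (hsc l).2
  have htT : t < T := by
    refine lt_of_le_of_ne ht.2 ?_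
    rintro rfl
    rw [hf.terminal_closure hT (box_subset_orthant hb) ⟨hs, hso⟩ i] at hpos'
    linarith
  have htI : t ∈ Ico t₀ T := ⟨htsQ.1.1, htT⟩
  have htIoo : t ∈ Ioo 0 T := ⟨ht₀.1.trans_le htI.1, htT⟩
  have hle (l) := RegimeSwitching.le_barrier (θ := θ) (κ := κ) hM hε.le hC0 ht.2 hso
    (fun l => (hsc l).2) l
  -- The artificial face $s_l=\delta$ is excluded: the logarithm there is already at least the bound
  -- $B$ of $f$.
  have hδlt (l) : δ < s l := by
    by_contra! h
    have h1 := hδB l _ (hso l) h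
    have h2 := (le_abs_self _).trans (hB t ht s ⟨hs, hso⟩ i)
    have h3 := hle l
    have h4 : 0 ≤ M * Real.exp (θ l * (Real.log (s l) - Real.log (u l)) + κ l * (T - t)) := by
      positivity
    linarith
  -- On a near facet $f\le0$ is below the positive barrier; on a far facet the $l$-th power is at
  -- least $M\ge f$.
  have hsbox : s ∈ box b u := by
    by_contra hn
    have hG : s ∈ Gam b u := mem_Gam.2 ⟨hs, hn, hso⟩
    by_cases hsu : ∀ l, s l < u l
    · linarith [hnear t htI s hG hsu i]
    · push Not at hsu
      obtain ⟨l, hl⟩ := hsu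
      have hl' : s l = u l := le_antisymm (hsc l).2 hl
      have h3 := hle l
      have h4 : M ≤ M * Real.exp (θ l * (Real.log (s l) - Real.log (u l)) + κ l * (T - t)) := by
        refine le_mul_of_one_le_right hM (Real.one_le_exp ?_)
        rw [hl']
        simpa using mul_nonneg (hκ0 l) (sub_nonneg.2 ht.2)
      have h5 : Real.log (u l) - Real.log (s l) = 0 := by rw [hl', sub_self]
      rw [h5, mul_zero] at h3
      linarith [hfar t htI s hG i]
  have hspace : IsLocalMax (fun x => F t x i) s := by
    have hopen : IsOpen (box (fun l => max (b l) δ) u) := isOpen_box _ _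
    filter_upwards [hopen.mem_nhds
      (show s ∈ _ from fun l => ⟨max_lt (hsbox l).1 (hδlt l), (hsbox l).2⟩)] with x hx
    exact hmax (t, x) ⟨htsQ.1, fun l _ => ⟨(hx l).1.le, (hx l).2.le⟩⟩ i
  have hfs := (hf.smooth i).contDiffAt (isOpen_box b u) htIoo hsbox
  have hbs := contDiffAt_barrier (T := T) (M := M) (ε := ε) (C := C) (u := u) (θ := θ) (κ := κ)
    t hso
  have hL : m.L (F t) s i ≤ 0 :=
    m.L_nonpos_of_isLocalMax (hfs.sub hbs) hspace (fun j => hmax (t, s) htsQ j) hpos.le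
  have hdt : deriv (fun τ => f τ s i) t - deriv (fun τ => barrier T M ε C u θ κ τ s) t ≤ 0 :=
    deriv_nonpos_of_le_right
      (((hf.smooth i).diff_time t htIoo s hsbox).hasDerivAt.sub
        (hasDerivAt_barrier t s).differentiableAt.hasDerivAt) htT
      fun τ hτ => hmax (τ, s) ⟨⟨htI.1.trans hτ.1.le, hτ.2.le⟩, htsQ.2⟩ i
  have hLs : m.L (F t) s i = m.L (f t) s i - m.L (fun x _ => barrier T M ε C u θ κ t x) s i :=
    m.L_sub (g := fun x _ => barrier T M ε C u θ κ t x) hfs hbs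
  have hst := barrier_strict m hM hε (hC i) (fun l => hκ l i) ht.2 hC0 hso fun l => (hsc l).2
  linarith [hf.pde t htIoo s hsbox i]

/-- Limit $\varepsilon\to0$ in the comparison. The starting time stays positive because the equation
holds only for $t\in(0,T)$; `IsClassicalSolution.le_sum_exp` reaches $t_0=0$ by continuity. -/
theorem IsClassicalSolution.le_sum_exp_of_pos {m : Model d k} {T : ℝ} (hT : 0 < T)
    {b u : Fin d → ℝ} (hb : ∀ l, 0 ≤ b l) (hbu : ∀ l, b l < u l)
    {f : ℝ → (Fin d → ℝ) → Fin k → ℝ} (hf : IsClassicalSolution m T (box b u) (fun _ => 0) f)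
    {t₀ M : ℝ} (ht₀ : t₀ ∈ Ioo 0 T) (hM : 0 ≤ M) {θ κ : Fin d → ℝ} (hκ0 : ∀ l, 0 ≤ κ l)
    (hκ : ∀ l i, m.r i * θ l + m.a i l l * θ l * (θ l - 1) / 2 - m.r i ≤ κ l)
    (hfar : ∀ t ∈ Ico t₀ T, ∀ s ∈ Gam b u, ∀ i, f t s i ≤ M)
    (hnear : ∀ t ∈ Ico t₀ T, ∀ s ∈ Gam b u, (∀ l, s l < u l) → ∀ i, f t s i ≤ 0)
    {s₀ : Fin d → ℝ} (hs₀ : s₀ ∈ box b u) (i₀ : Fin k) :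
    f t₀ s₀ i₀ ≤ M * ∑ l, Real.exp (θ l * (Real.log (s₀ l) - Real.log (u l)) +
      κ l * (T - t₀)) := by
  obtain ⟨C, hC⟩ : ∃ C, ∀ i, ∑ l, m.a i l l / 2 < C := by
    obtain ⟨C, hC⟩ := (finite_range fun i => ∑ l, m.a i l l / 2).bddAbove
    exact ⟨C + 1, fun i => (hC ⟨i, rfl⟩).trans_lt (lt_add_one C)⟩
  have key (ε : ℝ) (hε : 0 < ε) := hf.le_barrier hT hb hbu ht₀ hM hε (abs_nonneg C)
    (fun i => (hC i).trans_le (le_abs_self C)) hκ0 hκ hfar hnear hs₀ i₀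
  have hlim : Tendsto (fun ε => barrier T M ε |C| u θ κ t₀ s₀) (𝓝[>] 0)
      (𝓝 (barrier T M 0 |C| u θ κ t₀ s₀)) := by
    refine (Continuous.tendsto ?_ 0).mono_left nhdsWithin_le_nhds
    unfold barrier
    fun_prop
  have := ge_of_tendsto hlim (by filter_upwards [self_mem_nhdsWithin] with ε hε using key ε hε)
  simpa [barrier, Finset.mul_sum] using this

theorem IsClassicalSolution.le_sum_exp {m : Model d k} {T : ℝ} (hT : 0 < T)
    {b u : Fin d → ℝ} (hb : ∀ l, 0 ≤ b l) (hbu : ∀ l, b l < u l)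
    {f : ℝ → (Fin d → ℝ) → Fin k → ℝ} (hf : IsClassicalSolution m T (box b u) (fun _ => 0) f)
    {t₀ M : ℝ} (ht₀ : t₀ ∈ Ico 0 T) (hM : 0 ≤ M) {θ κ : Fin d → ℝ} (hκ0 : ∀ l, 0 ≤ κ l)
    (hκ : ∀ l i, m.r i * θ l + m.a i l l * θ l * (θ l - 1) / 2 - m.r i ≤ κ l)
    (hfar : ∀ t ∈ Ico t₀ T, ∀ s ∈ Gam b u, ∀ i, f t s i ≤ M)
    (hnear : ∀ t ∈ Ioo 0 T, ∀ s ∈ Gam b u, (∀ l, s l < u l) → ∀ i, f t s i ≤ 0)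
    {s₀ : Fin d → ℝ} (hs₀ : s₀ ∈ box b u) (i₀ : Fin k) :
    f t₀ s₀ i₀ ≤ M * ∑ l, Real.exp (θ l * (Real.log (s₀ l) - Real.log (u l)) +
      κ l * (T - t₀)) := by
  have key (t) (ht : t ∈ Ioo t₀ T) : f t s₀ i₀ ≤ M * ∑ l, Real.exp (θ l *
      (Real.log (s₀ l) - Real.log (u l)) + κ l * (T - t)) :=
    hf.le_sum_exp_of_pos hT hb hbu ⟨ht₀.1.trans_lt ht.1, ht.2⟩ hM hκ0 hκ
      (fun τ hτ => hfar τ ⟨ht.1.le.trans hτ.1, hτ.2⟩)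
      (fun τ hτ => hnear τ ⟨ht₀.1.trans_lt (ht.1.trans_le hτ.1), hτ.2⟩) hs₀ i₀
  have hf' : ContinuousOn (fun t => f t s₀ i₀) (Icc 0 T) :=
    (hf.cont i₀).comp (f := fun t => (t, s₀)) (by fun_prop)
      fun t ht => ⟨ht, subset_closure hs₀, box_subset_orthant hb hs₀⟩
  have h1 : Tendsto (fun t => f t s₀ i₀) (𝓝[Ioo t₀ T] t₀) (𝓝 (f t₀ s₀ i₀)) :=
    (hf' t₀ ⟨ht₀.1, ht₀.2.le⟩).mono_left
      (nhdsWithin_mono _ fun t ht => ⟨ht₀.1.trans ht.1.le, ht.2.le⟩)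
  have h2 : Continuous fun t => M * ∑ l, Real.exp (θ l *
      (Real.log (s₀ l) - Real.log (u l)) + κ l * (T - t)) := by fun_prop
  have : (𝓝[Ioo t₀ T] t₀).NeBot := left_nhdsWithin_Ioo_neBot ht₀.2
  exact le_of_tendsto_of_tendsto h1 ((h2.tendsto t₀).mono_left nhdsWithin_le_nhds)
    (by filter_upwards [self_mem_nhdsWithin] with t ht using key t ht)

/-! ### The choice of the exponents -/

/-- Here $y=\ln(u/s')$ and $\tau=T-t'$. For $D\le0$ the linear power $\theta=1$ gives equality. For
$D>0$, $a-2r\ge D$ makes $\kappa=A\theta^2/2$ admissible for every $\theta\ge0$. The target is the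
minimum over $\theta$ of $-\theta
y+\tfrac12A\theta^2\tau+\tfrac{A+D}{2D}\bigl(1-\tfrac{A\theta}{A+D}\bigr)^2$, and $\theta$ is its
minimiser; dropping the square gives the inequality. -/
theorem exists_exponents {A D τ y : ℝ} (hA : 0 < A) (hτ : 0 ≤ τ) (hy : 0 ≤ y) :
    ∃ θ κ : ℝ, 0 ≤ κ ∧
      (∀ a r, 0 ≤ r → a ≤ A → D ≤ a - 2 * r → r * θ + a * θ * (θ - 1) / 2 - r ≤ κ) ∧
      -(θ * y) + κ * τ ≤ (-y * (max D 0 / A * y + 2) + (A + |D|) * τ) /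
        (2 * (max D 0 * τ + A / (A + max D 0))) := by
  rcases le_or_gt D 0 with hD | hD
  · refine ⟨1, (A + |D|) / 2, by positivity, fun a r hr ha hDa => ?_, le_of_eq ?_⟩
    · have : 0 ≤ (A + |D|) / 2 := by positivity
      linarith
    · rw [max_eq_right hD]
      simp only [zero_div, zero_mul, add_zero, zero_add, div_self hA.ne']
      ring
  · rw [max_eq_left hD.le, abs_of_pos hD]
    have hc : 0 < A / (A + D) := by positivity
    set N := D * τ + A / (A + D) with hN
    have hN0 : 0 < N := by positivity
    refine ⟨(D * y + A) / (A * N), ((D * y + A) / (A * N)) ^ 2 * A / 2, by positivity,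
      fun a r hr ha hDa => ?_, ?_⟩
    · have hθ : 0 ≤ (D * y + A) / (A * N) := by positivity
      set θ := (D * y + A) / (A * N)
      have h1 := mul_nonneg (sq_nonneg θ) (sub_nonneg.2 ha)
      have h2 := mul_nonneg hθ (hD.le.trans hDa)
      nlinarith
    · have hτN : τ = (N - A / (A + D)) / D := by rw [hN]; field_simp; ring
      have hg : 0 ≤ (A + D) / (2 * D) * (1 - (D * y + A) / (A * N) * (A / (A + D))) ^ 2 := by
        positivity
      have h : (-y * (D / A * y + 2) + (A + D) * τ) / (2 * N) -
          (-((D * y + A) / (A * N) * y) + ((D * y + A) / (A * N)) ^ 2 * A / 2 * τ) =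
          (A + D) / (2 * D) * (1 - (D * y + A) / (A * N) * (A / (A + D))) ^ 2 := by
        clear_value N
        subst hτN
        field_simp
        ring
      linarith

/-- $a_{ll}$ is the squared norm of row $l$ of $\sigma$, and an invertible matrix has no zero row.
-/
theorem Model.a_diag_pos (m : Model d k) (i : Fin k) (l : Fin d) : 0 < m.a i l l := by
  have h : m.a i l l = ∑ n, m.σ i l n ^ 2 := by
    simp [Model.a, Matrix.mul_apply, sq]
  refine (h ▸ Finset.sum_nonneg fun n _ => sq_nonneg _ : 0 ≤ m.a i l l).lt_of_ne' fun h0 => ?_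
  rw [h, Finset.sum_eq_zero_iff_of_nonneg fun n _ => sq_nonneg _] at h0
  have hdet := ((Matrix.isUnit_iff_isUnit_det _).1 (m.σ_invertible i)).ne_zero
  exact hdet (Matrix.det_eq_zero_of_row_eq_zero l fun n => by simpa using h0 n (Finset.mem_univ n))

theorem Model.a_le_amax (m : Model d k) (i : Fin k) (l : Fin d) : m.a i l l ≤ m.amax l :=
  le_ciSup (finite_range fun i => m.a i l l).bddAbove i

theorem Model.D_le (m : Model d k) (i : Fin k) (l : Fin d) : m.D l ≤ m.a i l l - 2 * m.r i :=
  ciInf_le (finite_range fun i => m.a i l l - 2 * m.r i).bddBelow i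

end RegimeSwitching

/-! ### The error estimate -/

open RegimeSwitching in
theorem theorem4p7 {d k : ℕ} (m : RegimeSwitching.Model d k) (T : ℝ) (hT : 0 < T)
    (b u : Fin d → ℝ) (hb : ∀ l, 0 ≤ b l) (hbu : ∀ l, b l < u l)
    (K : (Fin d → ℝ) → ℝ) (hK0 : ∀ s ∈ RegimeSwitching.orthant d, 0 ≤ K s)
    (hKlip : ∃ C : NNReal, LipschitzOnWith C K (RegimeSwitching.orthant d))
    (h v w : ℝ → (Fin d → ℝ) → Fin k → ℝ)
    (hv : RegimeSwitching.SolvesFull m T K v)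
    (hw : RegimeSwitching.SolvesTruncated m T b u K h w)
    (hnear : ∀ t ∈ Set.Ioo 0 T, ∀ s ∈ RegimeSwitching.Gam b u, (∀ l, s l < u l) →
      ∀ i, h t s i = v t s i)
    (t' : ℝ) (ht' : t' ∈ Set.Icc 0 T) (s' : Fin d → ℝ) (hs' : s' ∈ RegimeSwitching.box b u)
    (i' : Fin k) :
    BddAbove (RegimeSwitching.boundaryErrors T b u v w t') ∧
    |v t' s' i' - w t' s' i'| ≤
      sSup (RegimeSwitching.boundaryErrors T b u v w t') *
        ∑ l : Fin d, Real.exp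
          ((-Real.log (u l / s' l) *
                (max (m.D l) 0 / m.amax l * Real.log (u l / s' l) + 2)
              + (m.amax l + |m.D l|) * (T - t'))
            / (2 * (max (m.D l) 0 * (T - t') + m.amax l / (m.amax l + max (m.D l) 0)))) := by
  have hsub := box_subset_orthant (u := u) hb
  have hwv : IsClassicalSolution m T (box b u) (fun _ => 0) fun t s i => w t s i - v t s i := by
    simpa using hw.1.sub (isOpen_box b u) (IsClassicalSolution.mono hv hsub)
  have hvw : IsClassicalSolution m T (box b u) (fun _ => 0) fun t s i => v t s i - w t s i := by
    simpa using (IsClassicalSolution.mono hv hsub).sub (isOpen_box b u) hw.1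
  have hbdd : BddAbove (boundaryErrors T b u v w t') := by
    obtain ⟨B, hB⟩ := hvw.exists_bound hbu
    refine ⟨B, ?_⟩
    rintro _ ⟨t, ht, s, hs, i, rfl⟩
    have hs1 := mem_Gam.1 hs
    exact hB t ⟨ht'.1.trans ht.1, ht.2.le⟩ s ⟨hs1.1, hs1.2.2⟩ i
  refine ⟨hbdd, ?_⟩
  set M := sSup (boundaryErrors T b u v w t')
  -- This includes the empty set, whose real `sSup` is `0`.
  have hM : 0 ≤ M := Real.sSup_nonneg (by rintro _ ⟨t, ht, s, hs, i, rfl⟩; exact abs_nonneg _)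
  rcases ht'.2.eq_or_lt with rfl | hlt
  · rw [hv.terminal s' (hsub hs') i', hw.1.terminal s' hs' i', sub_self, abs_zero]
    positivity
  have hfar (t) (ht : t ∈ Ico t' T) (s) (hs : s ∈ Gam b u) (i) : |v t s i - w t s i| ≤ M :=
    le_csSup hbdd ⟨t, ht, s, hs, i, rfl⟩
  have hzero (t) (ht : t ∈ Ioo 0 T) (s) (hs : s ∈ Gam b u) (hsu : ∀ l, s l < u l) (i) :
      w t s i = v t s i := (hw.2 t ht s hs i).trans (hnear t ht s hs hsu i)
  have hs0 := hsub hs'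
  have hy (l) : 0 ≤ Real.log (u l / s' l) :=
    Real.log_nonneg ((one_le_div (hs0 l)).2 (hs' l).2.le)
  -- The exponents are tuned to the evaluation point $(t',s')$ but work for all regimes at once;
  -- $i'$ only witnesses that a regime exists, so that $A_l>0$.
  choose θ κ hκ0 hκ hexp using fun l => exists_exponents (D := m.D l)
    ((m.a_diag_pos i' l).trans_le (m.a_le_amax i' l)) (sub_nonneg.2 ht'.2) (hy l)
  have hκ' (l i) := hκ l _ _ (m.r_nonneg i) (m.a_le_amax i l) (m.D_le i l)
  have h1 := hvw.le_sum_exp hT hb hbu ⟨ht'.1, hlt⟩ hM hκ0 hκ'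
    (fun t ht s hs i => (le_abs_self _).trans (hfar t ht s hs i))
    (fun t ht s hs hsu i => by simp [hzero t ht s hs hsu i]) hs' i'
  have h2 := hwv.le_sum_exp hT hb hbu ⟨ht'.1, hlt⟩ hM hκ0 hκ'
    (fun t ht s hs i => by
      rw [← neg_sub]; exact (neg_le_abs _).trans (hfar t ht s hs i))
    (fun t ht s hs hsu i => by simp [hzero t ht s hs hsu i]) hs' i'
  refine (abs_le'.2 ⟨h1, by rw [neg_sub]; exact h2⟩).trans
    (mul_le_mul_of_nonneg_left (Finset.sum_le_sum fun l _ => Real.exp_le_exp.2 ?_) hM)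
  refine le_trans (le_of_eq ?_) (hexp l)
  rw [Real.log_div ((hs0 l).trans (hs' l).2).ne' (hs0 l).ne']
  ring
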